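/- Graphs are finite and undirected and may have self-loops and parallel edges; surfaces are closed, connected and orientable. Let $H_3$ be the graph obtained from the complete bipartite graph $K_{2,3}$ by attaching a pendant vertex, called a free node, to each of its three $2$-valent vertices. Let $G$ be a connected graph, let $u,v,w$ be three distinct $2$-valent vertices of $G$, and let $G'$ be the graph obtained from the disjoint union of $G$ and $H_3$ by identifying the three free nodes of $H_3$, by some one-to-one matching, with $u,v,w$. Let $\Pi$ be a $2$-cell embedding of $G$ in a surface $S$, specified by its rotation system (a cyclic ordering of the edge-ends at each vertex). An embedding of $G'$ in a surface extends $\Pi$ if its rotations induce those of $\Pi$ on the edge-ends of $G$. Say that exactly $k$ handles are necessary and sufficient for extending $\Pi$ to $G'$ if the surface obtained from $S$ by adding $k$ handles has a $2$-cell embedding of $G'$ that extends $\Pi$, and no embedding of $G'$ in a surface of genus smaller than $\operatorname{genus}(S)+k$ extends $\Pi$. Then: 1. if $u,v,w$ all lie on the boundary of a single face of $\Pi$, exactly one handle is necessary and sufficient; 2. if some two of $u,v,w$ lie on the boundary of one face of $\Pi$, but no face boundary contains all three, exactly one handle is necessary and sufficient; 3. if no two of $u,v,w$ lie on the boundary of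 the same face of $\Pi$, exactly two handles are necessary and sufficient. -/

import Mathlib

/-- An undirected multigraph with vertex type `V` and edge type `E`; self-loops and parallel edges
are allowed.  Every edge `e` has two edge-ends `(e, false)` and `(e, true)`, and `G.vert d` is the
vertex with which the edge-end `d` is incident. -/
structure MultiGraph (V E : Type*) where
  vert : E × Bool → V

namespace MultiGraph

/-- The degree (valence) of a vertex: the number of edge-ends incident with it, so that a loop
counts twice. -/
noncomputable def degree {V E : Type*} (G : MultiGraph V E) (v : V) : ℕ :=
  Nat.card {d : E × Bool // G.vert d = v}

/-- The graph is (nonempty and) connected. -/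
def Connected {V E : Type*} (G : MultiGraph V E) : Prop :=
  (SimpleGraph.fromRel
    (fun x y : V => ∃ e : E, G.vert (e, false) = x ∧ G.vert (e, true) = y)).Connected

/-- Glue `G` to a graph `H`, whose vertices are split into attaching vertices `B` and further
vertices `C`, by identifying each attaching vertex `b` of `H` with the vertex `t b` of `G`. -/
def attach {V E B C F : Type*} (G : MultiGraph V E) (H : MultiGraph (B ⊕ C) F) (t : B → V) :
    MultiGraph (V ⊕ C) (E ⊕ F) where
  vert d := match d with
    | (Sum.inl e, s) => Sum.inl (G.vert (e, s))
    | (Sum.inr f, s) => Sum.map t id (H.vert (f, s))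

/-- The graph `H₃`: the complete bipartite graph `K_{2,3}` with a pendant vertex attached to each of
its three 2-valent vertices.  The vertices are the three free nodes `inl i`, the three vertices
`inr (inl i)` in the 3-element part of `K_{2,3}`, and the two vertices `inr (inr j)` in the other
part.  The edges are the six edges `inl (i, j)` of `K_{2,3}` and the three free edges `inr i`. -/
def H3 : MultiGraph (Fin 3 ⊕ (Fin 3 ⊕ Fin 2)) ((Fin 3 × Fin 2) ⊕ Fin 3) where
  vert d := match d with
    | (Sum.inl (i, _), false) => Sum.inr (Sum.inl i)
    | (Sum.inl (_, j), true) => Sum.inr (Sum.inr j)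
    | (Sum.inr i, false) => Sum.inl i
    | (Sum.inr i, true) => Sum.inr (Sum.inl i)

/-- A rotation system: a permutation of the edge-ends whose orbits are exactly the sets of
edge-ends incident with a common vertex, that is, a cyclic ordering of the edge-ends at every
vertex.  For a connected graph, rotation systems are the same as 2-cell embeddings in closed
oriented surfaces, up to equivalence. -/
structure Rotation {V E : Type*} (G : MultiGraph V E) where
  next : Equiv.Perm (E × Bool)
  sameCycle_iff : ∀ d d' : E × Bool, next.SameCycle d d' ↔ G.vert d = G.vert d'

namespace Rotation

/-- Face tracing: traverse the edge of `d` starting from the end `d`, and leave the vertex that is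
reached through the edge-end that follows in the rotation there. -/
def faceStep {V E : Type*} {G : MultiGraph V E} (P : G.Rotation) : Equiv.Perm (E × Bool) :=
  (Equiv.prodCongr (Equiv.refl E) Equiv.boolNot).trans P.next

/-- The faces of the embedding: the orbits of face tracing. -/
def Face {V E : Type*} {G : MultiGraph V E} (P : G.Rotation) : Type _ :=
  Quotient (Equiv.Perm.SameCycle.setoid P.faceStep)

/-- The vertex `v` lies on the boundary of the face `f`. -/
def OnBoundary {V E : Type*} {G : MultiGraph V E} (P : G.Rotation) (v : V) (f : P.Face) : Prop :=
  ∃ d : E × Bool, Quotient.mk (Equiv.Perm.SameCycle.setoid P.faceStep) d = f ∧ G.vert d = v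

/-- The Euler characteristic `|V| - |E| + |F|` of the surface of the 2-cell embedding (of a
connected graph with at least one edge).  The surface of genus `g` has Euler characteristic
`2 - 2 g`, so adding a handle lowers it by `2`. -/
noncomputable def eulerChar {V E : Type*} {G : MultiGraph V E} (P : G.Rotation) : ℤ :=
  (Nat.card V : ℤ) - (Nat.card E : ℤ) + (Nat.card P.Face : ℤ)

/-- The embedding `Q` of `G.attach H t` extends the embedding `P` of `G`: the rotations of `Q`
induce those of `P` on the edge-ends of `G`, i.e. the successor of an edge-end of `G` under `P` is
the first edge-end of `G` that comes after it in the rotation of `Q`. -/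
def Extends {V E B C F : Type*} {G : MultiGraph V E} {H : MultiGraph (B ⊕ C) F} {t : B → V}
    (Q : (G.attach H t).Rotation) (P : G.Rotation) : Prop :=
  ∀ d : E × Bool, ∃ n : ℕ, 0 < n ∧
    (Q.next ^ n) (Sum.inl d.1, d.2) = (Sum.inl (P.next d).1, (P.next d).2) ∧
    ∀ m : ℕ, 0 < m → m < n → ∀ d' : E × Bool,
      (Q.next ^ m) (Sum.inl d.1, d.2) ≠ (Sum.inl d'.1, d'.2)

/-- Exactly `k` handles have to be added to the surface of `P` in order to extend `P` to an
embedding of `G.attach H t`.  Sufficiency: some extension is a 2-cell embedding in the surface with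
`k` handles added.  Necessity: every extension has a surface that arises by adding at least `k`
handles.  (An extension in a surface that is not a 2-cell embedding has a rotation system whose own
surface has smaller genus, so necessity covers it.) -/
def HandlesNecessaryAndSufficient {V E B C F : Type*} {G : MultiGraph V E} (P : G.Rotation)
    (H : MultiGraph (B ⊕ C) F) (t : B → V) (k : ℕ) : Prop :=
  (∃ Q : (G.attach H t).Rotation, Q.Extends P ∧ Q.eulerChar = P.eulerChar - 2 * (k : ℤ)) ∧
  (∀ Q : (G.attach H t).Rotation, Q.Extends P → Q.eulerChar ≤ P.eulerChar - 2 * (k : ℤ))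

end Rotation

end MultiGraph

/-! Everything reduces to counting cycles of permutations. Since `u`, `v`, `w` are distinct and
every trivalent vertex of `H3` has just two cyclic orders, an extension of `P` amounts to choosing
an edge-end `d i` of `G` at each `t i`, in front of which the `i`-th free edge enters, and
orientations `a`, `b` of the trivalent vertices (`exists_extension`, `exists_next_eq`). Its face
permutation is the disjoint sum of those of `P` and of `H3`, multiplied by the three transpositions
exchanging `d i` with `freeEnd i` (`card_face_of_next_eq`).

A transposition merges two cycles or splits one, so it changes the number of faces by one. The first
always merges a face of `P` with a face of `H3`; a later one can split only if both its face of `P`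
and its face of `H3` have been used before. Gluing adds 5 vertices and 9 edges, so with `F` faces of
`P`, adding `k` handles means ending with `F + 4 - 2k` faces.

An embedding of `H3` has three faces or one. With three, no face contains all free edges, so at most
one transposition splits, leaving at most `F + 3 - 1` faces; with one, at most two split, leaving at
most `F + 1 + 1`. Hence one handle is always necessary. If two of the attaching vertices share a
face, a planar `H3` with just the matching two free edges in a common face gives merge, split,
merge, hence `F + 2` faces. If no two share a face, all three transpositions merge, leaving at most
`F` faces, with equality for planar `H3`. -/

namespace Equiv.Perm

/-! ### Cycle counts under multiplication by a transposition -/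

/-- The number of cycles of a permutation, fixed points included. -/
noncomputable def cycleCount {α : Type*} (f : Perm α) : ℕ :=
  Nat.card (Quotient (SameCycle.setoid f))

/-- The standard tool below for separating cycles: exhibit a function constant along `f` that
distinguishes the two points. -/
theorem SameCycle.eq_of_invariant {α γ : Type*} {f : Perm α} {q : α → γ}
    (hq : ∀ x, q (f x) = q x) {x y : α} (h : f.SameCycle x y) : q x = q y := by
  obtain ⟨i, rfl⟩ := h
  have hinv : ∀ x, q (f⁻¹ x) = q x := fun x => by simpa using (hq (f⁻¹ x)).symm
  induction i using Int.induction_on with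
  | zero => rfl
  | succ n ih => rw [add_comm, zpow_one_add, mul_apply, hq]; exact ih
  | pred n ih =>
    rw [sub_eq_add_neg, add_comm, zpow_add, zpow_neg_one, mul_apply, hinv]; exact ih

theorem SameCycle.of_step {α : Type*} {f g : Perm α} (hfg : ∀ x, g.SameCycle (f x) x)
    {x y : α} (h : f.SameCycle x y) : g.SameCycle x y :=
  Quotient.exact (s := SameCycle.setoid g)
    (h.eq_of_invariant (q := Quotient.mk (SameCycle.setoid g)) fun z => Quotient.sound (hfg z))

theorem invariant_swap_mul {α γ : Type*} [DecidableEq α] {f : Perm α} {q : α → γ}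
    (hq : ∀ x, q (f x) = q x) {a b : α} (hab : q a = q b) (x : α) :
    q ((swap a b * f) x) = q x := by
  rw [mul_apply, swap_apply_def]
  split_ifs with h₁ h₂
  · rw [← hab, ← h₁, hq]
  · rw [hab, ← h₂, hq]
  · exact hq x

/-- Starting at `a`, the product follows `f` until the first return to `a`, which the transposition
redirects to `b`. -/
theorem sameCycle_swap_mul {α : Type*} [Finite α] [DecidableEq α] {f : Perm α} {a b : α}
    (h : ¬ f.SameCycle a b) : (swap a b * f).SameCycle a b := by
  classical
  have hex : ∃ n, 0 < n ∧ (f ^ n) a = a := by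
    obtain ⟨n, hn, -, hna⟩ := (SameCycle.refl f a).exists_pow_eq''
    exact ⟨n, hn, hna⟩
  obtain ⟨hpos, hret⟩ := Nat.find_spec hex
  have hmin : ∀ m, 0 < m → m < Nat.find hex → (f ^ m) a ≠ a :=
    fun m hm hlt heq => Nat.find_min hex hlt ⟨hm, heq⟩
  generalize Nat.find hex = n at hpos hret hmin
  have key : ∀ m < n, ((swap a b * f) ^ m) a = (f ^ m) a := by
    intro m
    induction m with
    | zero => intro _; rfl
    | succ m ih =>
      intro hm
      rw [pow_succ', mul_apply, ih (by omega), mul_apply, ← mul_apply f, ← pow_succ',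
        swap_apply_of_ne_of_ne (hmin _ (by omega) hm)]
      intro hb
      exact h ⟨(m + 1 : ℕ), by rw [zpow_natCast]; exact hb⟩
  obtain ⟨m, rfl⟩ : ∃ m, n = m + 1 := ⟨n - 1, by omega⟩
  refine ⟨(m + 1 : ℕ), ?_⟩
  rw [zpow_natCast, pow_succ', mul_apply, key m (by omega), mul_apply, ← mul_apply f, ← pow_succ',
    hret, swap_apply_left]

/-- Starting at `a`, the product follows `f` until it would first reach `b`; there the transposition
sends it back to `a`, so the orbit closes without `b`. -/
theorem not_sameCycle_swap_mul {α : Type*} [Finite α] [DecidableEq α] {f : Perm α} {a b : α}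
    (hab : a ≠ b) (h : f.SameCycle a b) : ¬ (swap a b * f).SameCycle a b := by
  classical
  have hex : ∃ n, 0 < n ∧ (f ^ n) a = b := by
    obtain ⟨n, hn, -, hna⟩ := h.exists_pow_eq''
    exact ⟨n, hn, hna⟩
  obtain ⟨hpos, hret⟩ := Nat.find_spec hex
  have hmin : ∀ m, 0 < m → m < Nat.find hex → (f ^ m) a ≠ b :=
    fun m hm hlt heq => Nat.find_min hex hlt ⟨hm, heq⟩
  generalize Nat.find hex = n at hpos hret hmin
  have hne : ∀ m, 0 < m → m < n → (f ^ m) a ≠ a := by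
    intro m hm hlt heq
    refine hmin (n - m) (by omega) (by omega) ?_
    rw [← hret]
    conv_rhs => rw [show n = n - m + m by omega, pow_add, mul_apply, heq]
  have key : ∀ m < n, ((swap a b * f) ^ m) a = (f ^ m) a := by
    intro m
    induction m with
    | zero => intro _; rfl
    | succ m ih =>
      intro hm
      rw [pow_succ', mul_apply, ih (by omega), mul_apply, ← mul_apply f, ← pow_succ',
        swap_apply_of_ne_of_ne (hne _ (by omega) hm) (hmin _ (by omega) hm)]
  have hper : ((swap a b * f) ^ n) a = a := by
    obtain ⟨m, rfl⟩ : ∃ m, n = m + 1 := ⟨n - 1, by omega⟩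
    rw [pow_succ', mul_apply, key m (by omega), mul_apply, ← mul_apply f, ← pow_succ',
      hret, swap_apply_right]
  intro hs
  obtain ⟨k, -, -, hk⟩ := hs.exists_pow_eq''
  have hmod : ((swap a b * f) ^ (k % n)) a = b := by
    refine Eq.trans ?_ hk
    conv_rhs => rw [← Nat.mod_add_div k n, pow_add, mul_apply, pow_mul,
      pow_apply_eq_self_of_apply_eq_self hper]
  have hlt := Nat.mod_lt k hpos
  rw [key _ hlt] at hmod
  rcases Nat.eq_zero_or_pos (k % n) with h0 | h0
  · rw [h0] at hmod
    exact hab hmod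
  · exact hmin _ h0 hlt hmod

theorem SameCycle.swap_mul {α : Type*} [Finite α] [DecidableEq α] {f : Perm α} {a b x y : α}
    (h : ¬ f.SameCycle a b) (hxy : f.SameCycle x y) : (swap a b * f).SameCycle x y := by
  refine hxy.of_step fun z => ?_
  have hz : (swap a b * f).SameCycle ((swap a b * f) z) z := sameCycle_apply_left.2 (.refl _ _)
  rw [mul_apply, swap_apply_def] at hz
  have hm := sameCycle_swap_mul h
  split_ifs at hz with h₁ h₂
  · rw [h₁]; exact hm.trans hz
  · rw [h₂]; exact hm.symm.trans hz
  · exact hz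

theorem cycleCount_swap_mul_of_not_sameCycle {α : Type*} [Finite α] [DecidableEq α]
    {f : Perm α} {a b : α} (h : ¬ f.SameCycle a b) :
    (swap a b * f).cycleCount + 1 = f.cycleCount := by
  classical
  let s := SameCycle.setoid f
  -- Relabels the cycle of `b` as that of `a`. This is invariant under the product, and its values
  -- are all the cycles of `f` except that of `b`.
  let q : α → Quotient s := fun x => if f.SameCycle x b then Quotient.mk s a else Quotient.mk s x
  have hqf : ∀ x, q (f x) = q x := by
    intro x
    have hx : f.SameCycle (f x) x := sameCycle_apply_left.2 (.refl _ _)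
    have hx' : Quotient.mk s (f x) = Quotient.mk s x := Quotient.sound hx
    simp only [q, sameCycle_apply_left, hx']
  have hqab : q a = q b := by simp [q, SameCycle.refl]
  let F : Quotient (SameCycle.setoid (swap a b * f)) → {c : Quotient s // c ≠ Quotient.mk s b} :=
    Quotient.lift (fun x => ⟨q x, by
        by_cases hx : f.SameCycle x b
        · simp only [q, if_pos hx]
          exact fun he => h (Quotient.exact he)
        · simp only [q, if_neg hx]
          exact fun he => hx (Quotient.exact he)⟩)
      fun x y hxy => Subtype.ext (SameCycle.eq_of_invariant (invariant_swap_mul hqf hqab) hxy)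
  have hF : Function.Bijective F := by
    constructor
    · rintro ⟨x⟩ ⟨y⟩ hxy
      have hxy' : q x = q y := congrArg Subtype.val hxy
      refine Quotient.sound (?_ : (swap a b * f).SameCycle x y)
      have hm := sameCycle_swap_mul h
      have up : ∀ {u v : α}, f.SameCycle u v → (swap a b * f).SameCycle u v :=
        fun huv => huv.swap_mul h
      by_cases hx : f.SameCycle x b <;> by_cases hy : f.SameCycle y b <;>
        simp only [q, hx, hy, if_true, if_false] at hxy'
      · exact up (hx.trans hy.symm)
      · exact ((up hx).trans hm.symm).trans (up (Quotient.exact hxy'))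
      · exact (up (Quotient.exact hxy')).trans (hm.trans (up hy.symm))
      · exact up (Quotient.exact hxy')
    · rintro ⟨⟨x⟩, hx⟩
      refine ⟨Quotient.mk _ x, Subtype.ext ?_⟩
      have : ¬ f.SameCycle x b := fun he => hx (Quotient.sound he)
      exact if_neg this
  have hcard := Nat.card_congr (Equiv.ofBijective F hF)
  have : Fintype (Quotient s) := Fintype.ofFinite _
  have hpos : 0 < Fintype.card (Quotient s) := Fintype.card_pos_iff.2 ⟨Quotient.mk s b⟩
  unfold cycleCount
  rw [hcard, Nat.card_eq_fintype_card, Nat.card_eq_fintype_card]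
  have := Fintype.card_subtype_compl (fun c : Quotient s => c = Quotient.mk s b)
  rw [Fintype.card_subtype_eq] at this
  change Fintype.card {c : Quotient s // ¬ c = Quotient.mk s b} + 1 = Fintype.card (Quotient s)
  omega

/-- The merging case read backwards: multiplying by the transposition again recovers `f`. -/
theorem cycleCount_swap_mul_of_sameCycle {α : Type*} [Finite α] [DecidableEq α]
    {f : Perm α} {a b : α} (hab : a ≠ b) (h : f.SameCycle a b) :
    (swap a b * f).cycleCount = f.cycleCount + 1 := by
  have := cycleCount_swap_mul_of_not_sameCycle (not_sameCycle_swap_mul hab h)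
  rw [← mul_assoc, swap_mul_self, one_mul] at this
  exact this.symm

theorem cycleCount_swap_mul_le {α : Type*} [Finite α] [DecidableEq α]
    {f : Perm α} {a b : α} (hab : a ≠ b) : (swap a b * f).cycleCount ≤ f.cycleCount + 1 := by
  by_cases h : f.SameCycle a b
  · exact (cycleCount_swap_mul_of_sameCycle hab h).le
  · have := cycleCount_swap_mul_of_not_sameCycle h
    omega

theorem SameCycle.map {α β : Type*} {f : Perm α} {g : Perm β} {e : α → β}
    (he : ∀ x, e (f x) = g (e x)) {x y : α} (h : f.SameCycle x y) : g.SameCycle (e x) (e y) :=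
  Quotient.exact (s := SameCycle.setoid g)
    (h.eq_of_invariant (q := fun z => Quotient.mk (SameCycle.setoid g) (e z)) fun z => by
      rw [he]
      exact Quotient.sound (s := SameCycle.setoid g) (sameCycle_apply_left.2 (.refl g (e z))))

theorem sameCycle_permCongr {α β : Type*} (e : α ≃ β) (f : Perm α) {x y : α} :
    (e.permCongr f).SameCycle (e x) (e y) ↔ f.SameCycle x y := by
  refine ⟨fun h => ?_, fun h => h.map fun z => by simp⟩
  simpa using h.map (e := e.symm) (g := f) fun z => by simp

theorem cycleCount_permCongr {α β : Type*} (e : α ≃ β) (f : Perm α) :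
    (e.permCongr f).cycleCount = f.cycleCount :=
  (Nat.card_congr (Quotient.congr e fun _ _ => (sameCycle_permCongr e f).symm)).symm

/-! ### Joining two disjoint permutations by three transpositions -/

section Sum

variable {A B : Type*}

theorem sameCycle_sumCongr_inl (f : Perm A) (g : Perm B) {a a' : A} :
    (sumCongr f g).SameCycle (Sum.inl a) (Sum.inl a') ↔ f.SameCycle a a' := by
  refine ⟨fun h => ?_, fun h => h.map fun z => by simp⟩
  have := h.eq_of_invariant
    (q := Sum.elim (fun z => some (Quotient.mk (SameCycle.setoid f) z)) (fun _ => none))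
    (by
      rintro (z | z)
      · exact congrArg some (Quotient.sound (s := SameCycle.setoid f)
          (sameCycle_apply_left.2 (.refl f z)))
      · rfl)
  exact Quotient.exact (Option.some.inj this)

theorem sameCycle_sumCongr_inr (f : Perm A) (g : Perm B) {b b' : B} :
    (sumCongr f g).SameCycle (Sum.inr b) (Sum.inr b') ↔ g.SameCycle b b' := by
  refine ⟨fun h => ?_, fun h => h.map fun z => by simp⟩
  have := h.eq_of_invariant
    (q := Sum.elim (fun _ => none) (fun z => some (Quotient.mk (SameCycle.setoid g) z)))
    (by
      rintro (z | z)
      · rfl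
      · exact congrArg some (Quotient.sound (s := SameCycle.setoid g)
          (sameCycle_apply_left.2 (.refl g z))))
  exact Quotient.exact (Option.some.inj this)

theorem not_sameCycle_sumCongr (f : Perm A) (g : Perm B) {a : A} {b : B} :
    ¬ (sumCongr f g).SameCycle (Sum.inl a) (Sum.inr b) := fun h => by
  have := h.eq_of_invariant (q := Sum.isLeft) (by rintro (z | z) <;> rfl)
  simp at this

theorem cycleCount_sumCongr [Finite A] [Finite B] (f : Perm A) (g : Perm B) :
    (sumCongr f g).cycleCount = f.cycleCount + g.cycleCount := by
  let F : Quotient (SameCycle.setoid f) ⊕ Quotient (SameCycle.setoid g) →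
      Quotient (SameCycle.setoid (sumCongr f g)) :=
    Sum.elim (Quotient.map Sum.inl fun _ _ h => (sameCycle_sumCongr_inl f g).2 h)
      (Quotient.map Sum.inr fun _ _ h => (sameCycle_sumCongr_inr f g).2 h)
  have hF : Function.Bijective F := by
    constructor
    · rintro (a | a) (b | b) h <;> obtain ⟨a⟩ := a <;> obtain ⟨b⟩ := b
      · have h' : f.SameCycle a b := (sameCycle_sumCongr_inl f g).1
          (Quotient.exact (s := SameCycle.setoid (sumCongr f g)) h)
        exact congrArg Sum.inl (Quotient.sound (s := SameCycle.setoid f) h')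
      · exact (not_sameCycle_sumCongr f g
          (Quotient.exact (s := SameCycle.setoid (sumCongr f g)) h)).elim
      · exact (not_sameCycle_sumCongr f g
          (Quotient.exact (s := SameCycle.setoid (sumCongr f g)) h.symm)).elim
      · have h' : g.SameCycle a b := (sameCycle_sumCongr_inr f g).1
          (Quotient.exact (s := SameCycle.setoid (sumCongr f g)) h)
        exact congrArg Sum.inr (Quotient.sound (s := SameCycle.setoid g) h')
    · rintro ⟨a | b⟩
      · exact ⟨Sum.inl (Quotient.mk _ a), rfl⟩
      · exact ⟨Sum.inr (Quotient.mk _ b), rfl⟩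
  rw [cycleCount, ← Nat.card_congr (Equiv.ofBijective F hF), Nat.card_sum]
  rfl

theorem sumCongr_invariant_left (f : Perm A) (g : Perm B) (a : A) (z : A ⊕ B) :
    Sum.elim (fun a' => f.SameCycle a a') (fun _ => False) (sumCongr f g z) =
      Sum.elim (fun a' => f.SameCycle a a') (fun _ => False) z := by
  rcases z with z | z <;> simp

theorem sumCongr_invariant_right (f : Perm A) (g : Perm B) (b : B) (z : A ⊕ B) :
    Sum.elim (fun _ => False) (fun b' => g.SameCycle b b') (sumCongr f g z) =
      Sum.elim (fun _ => False) (fun b' => g.SameCycle b b') z := by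
  rcases z with z | z <;> simp

variable [DecidableEq A] [DecidableEq B]

/-- The involution that exchanges `d i` in the left summand with `x i` in the right summand, for
three values of `i`. -/
def crossSwap (d : Fin 3 → A) (x : Fin 3 → B) : Perm (A ⊕ B) :=
  swap (Sum.inl (d 2)) (Sum.inr (x 2)) *
    (swap (Sum.inl (d 1)) (Sum.inr (x 1)) * swap (Sum.inl (d 0)) (Sum.inr (x 0)))

theorem crossSwap_inl {d : Fin 3 → A} {x : Fin 3 → B} (hd : d.Injective) (hx : x.Injective)
    (i : Fin 3) : crossSwap d x (Sum.inl (d i)) = Sum.inr (x i) := by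
  fin_cases i <;> simp [crossSwap, swap_apply_def, hd.eq_iff, hx.eq_iff]

theorem crossSwap_inr {d : Fin 3 → A} {x : Fin 3 → B} (hd : d.Injective) (hx : x.Injective)
    (i : Fin 3) : crossSwap d x (Sum.inr (x i)) = Sum.inl (d i) := by
  fin_cases i <;> simp [crossSwap, swap_apply_def, hd.eq_iff, hx.eq_iff]

theorem crossSwap_inl_of_ne {d : Fin 3 → A} {x : Fin 3 → B} {a : A} (ha : ∀ i, d i ≠ a) :
    crossSwap d x (Sum.inl a) = Sum.inl a := by
  simp [crossSwap, swap_apply_def, fun i => (ha i).symm]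

theorem crossSwap_inr_of_ne {d : Fin 3 → A} {x : Fin 3 → B} {b : B} (hb : ∀ i, x i ≠ b) :
    crossSwap d x (Sum.inr b) = Sum.inr b := by
  simp [crossSwap, swap_apply_def, fun i => (hb i).symm]

/-- The three transpositions are disjoint, so their order is immaterial. This allows the pair on a
common face to be processed first. -/
theorem crossSwap_comp {d : Fin 3 → A} {x : Fin 3 → B} (hd : d.Injective) (hx : x.Injective)
    (π : Perm (Fin 3)) : crossSwap (d ∘ π) (x ∘ π) = crossSwap d x := by
  have hd' := hd.comp π.injective
  have hx' := hx.comp π.injective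
  ext (a | b)
  · by_cases ha : ∃ i, d i = a
    · obtain ⟨i, rfl⟩ := ha
      have := crossSwap_inl hd' hx' (π.symm i)
      simp only [Function.comp_apply, apply_symm_apply] at this
      rw [this, crossSwap_inl hd hx]
    · push Not at ha
      rw [crossSwap_inl_of_ne ha, crossSwap_inl_of_ne (d := d ∘ π) fun i => ha (π i)]
  · by_cases hb : ∃ i, x i = b
    · obtain ⟨i, rfl⟩ := hb
      have := crossSwap_inr hd' hx' (π.symm i)
      simp only [Function.comp_apply, apply_symm_apply] at this
      rw [this, crossSwap_inr hd hx]
    · push Not at hb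
      rw [crossSwap_inr_of_ne hb, crossSwap_inr_of_ne (x := x ∘ π) fun i => hb (π i)]

theorem crossSwap_mul (d : Fin 3 → A) (x : Fin 3 → B) (f : Perm (A ⊕ B)) :
    crossSwap d x * f = swap (Sum.inl (d 2)) (Sum.inr (x 2)) *
      (swap (Sum.inl (d 1)) (Sum.inr (x 1)) * (swap (Sum.inl (d 0)) (Sum.inr (x 0)) * f)) := by
  simp only [crossSwap, mul_assoc]

variable (f : Perm A) (g : Perm B) (d : Fin 3 → A) (x : Fin 3 → B)

/-- On a side where the second point lies off the cycle of the first, its cycle is untouched by the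
first transposition and so still omits the point on the other side. -/
theorem not_sameCycle_swap_mul_sumCongr (h : ¬ (f.SameCycle (d 1) (d 0) ∧
      g.SameCycle (x 1) (x 0))) :
    ¬ (swap (Sum.inl (d 0)) (Sum.inr (x 0)) * sumCongr f g).SameCycle
      (Sum.inl (d 1)) (Sum.inr (x 1)) := fun hs => by
  by_cases hf : f.SameCycle (d 1) (d 0)
  · have := hs.eq_of_invariant (invariant_swap_mul (sumCongr_invariant_right f g (x 1))
      (by simpa using fun hg => h ⟨hf, hg⟩))
    simp [SameCycle.refl] at this
  · have := hs.eq_of_invariant (invariant_swap_mul (sumCongr_invariant_left f g (d 1))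
      (by simpa using hf))
    simp [SameCycle.refl] at this

theorem not_sameCycle_swap_mul_swap_mul_sumCongr
    (h : (¬ f.SameCycle (d 2) (d 0) ∧ ¬ f.SameCycle (d 2) (d 1)) ∨
      (¬ g.SameCycle (x 2) (x 0) ∧ ¬ g.SameCycle (x 2) (x 1))) :
    ¬ (swap (Sum.inl (d 1)) (Sum.inr (x 1)) * (swap (Sum.inl (d 0)) (Sum.inr (x 0)) *
      sumCongr f g)).SameCycle (Sum.inl (d 2)) (Sum.inr (x 2)) := fun hs => by
  rcases h with ⟨h₀, h₁⟩ | ⟨h₀, h₁⟩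
  · have := hs.eq_of_invariant (invariant_swap_mul (invariant_swap_mul
      (sumCongr_invariant_left f g (d 2)) (by simpa using h₀)) (by simpa using h₁))
    simp [SameCycle.refl] at this
  · have := hs.eq_of_invariant (invariant_swap_mul (invariant_swap_mul
      (sumCongr_invariant_right f g (x 2)) (by simpa using h₀)) (by simpa using h₁))
    simp [SameCycle.refl] at this

variable [Finite A] [Finite B]

theorem cycleCount_swap_mul_sumCongr (a : A) (b : B) :
    (swap (Sum.inl a) (Sum.inr b) * sumCongr f g).cycleCount + 1 =
      f.cycleCount + g.cycleCount := by
  rw [cycleCount_swap_mul_of_not_sameCycle (not_sameCycle_sumCongr f g), cycleCount_sumCongr]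

theorem cycleCount_crossSwap_mul_le :
    (crossSwap d x * sumCongr f g).cycleCount ≤ f.cycleCount + g.cycleCount + 1 := by
  have h₀ := cycleCount_swap_mul_sumCongr f g (d 0) (x 0)
  have h₁ := cycleCount_swap_mul_le (f := swap (Sum.inl (d 0)) (Sum.inr (x 0)) * sumCongr f g)
    (a := Sum.inl (d 1)) (b := Sum.inr (x 1)) (by simp)
  have h₂ := cycleCount_swap_mul_le (f := swap (Sum.inl (d 1)) (Sum.inr (x 1)) *
    (swap (Sum.inl (d 0)) (Sum.inr (x 0)) * sumCongr f g))
    (a := Sum.inl (d 2)) (b := Sum.inr (x 2)) (by simp)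
  rw [crossSwap_mul]
  omega

/-- The first transposition merges, and so does the second or the third: whichever first meets a new
cycle of `g`. -/
theorem cycleCount_crossSwap_mul_lt (h : ¬ (g.SameCycle (x 1) (x 0) ∧ g.SameCycle (x 2) (x 0))) :
    (crossSwap d x * sumCongr f g).cycleCount + 1 ≤ f.cycleCount + g.cycleCount := by
  have h₀ := cycleCount_swap_mul_sumCongr f g (d 0) (x 0)
  rw [crossSwap_mul]
  by_cases h₁ : g.SameCycle (x 1) (x 0)
  · have h₂ : ¬ g.SameCycle (x 2) (x 0) := fun h₂ => h ⟨h₁, h₂⟩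
    have := cycleCount_swap_mul_of_not_sameCycle (not_sameCycle_swap_mul_swap_mul_sumCongr f g d x
      (.inr ⟨h₂, fun h₃ => h₂ (h₃.trans h₁)⟩))
    have := cycleCount_swap_mul_le (f := swap (Sum.inl (d 0)) (Sum.inr (x 0)) * sumCongr f g)
      (a := Sum.inl (d 1)) (b := Sum.inr (x 1)) (by simp)
    omega
  · have := cycleCount_swap_mul_of_not_sameCycle (not_sameCycle_swap_mul_sumCongr f g d x
      fun h' => h₁ h'.2)
    have := cycleCount_swap_mul_le (f := swap (Sum.inl (d 1)) (Sum.inr (x 1)) *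
      (swap (Sum.inl (d 0)) (Sum.inr (x 0)) * sumCongr f g))
      (a := Sum.inl (d 2)) (b := Sum.inr (x 2)) (by simp)
    omega

theorem cycleCount_crossSwap_mul_of_pairwise (h : ∀ i j, i ≠ j → ¬ f.SameCycle (d i) (d j)) :
    (crossSwap d x * sumCongr f g).cycleCount + 3 = f.cycleCount + g.cycleCount := by
  have h₀ := cycleCount_swap_mul_sumCongr f g (d 0) (x 0)
  have h₁ := cycleCount_swap_mul_of_not_sameCycle (not_sameCycle_swap_mul_sumCongr f g d x
    fun h' => h 1 0 (by decide) h'.1)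
  have h₂ := cycleCount_swap_mul_of_not_sameCycle (not_sameCycle_swap_mul_swap_mul_sumCongr f g d x
    (.inl ⟨h 2 0 (by decide), h 2 1 (by decide)⟩))
  rw [crossSwap_mul]
  omega

/-- The pattern is merge, split, merge. -/
theorem cycleCount_crossSwap_mul_of_pair (hd : f.SameCycle (d 1) (d 0))
    (hx : g.SameCycle (x 1) (x 0)) (hx' : ¬ g.SameCycle (x 2) (x 0)) :
    (crossSwap d x * sumCongr f g).cycleCount + 1 = f.cycleCount + g.cycleCount := by
  have h₀ := cycleCount_swap_mul_sumCongr f g (d 0) (x 0)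
  have hn : ¬ (sumCongr f g).SameCycle (Sum.inl (d 0)) (Sum.inr (x 0)) :=
    not_sameCycle_sumCongr f g
  have h₁ := cycleCount_swap_mul_of_sameCycle (a := Sum.inl (d 1)) (b := Sum.inr (x 1)) (by simp)
    (((((sameCycle_sumCongr_inl f g).2 hd).swap_mul hn).trans (sameCycle_swap_mul hn)).trans
      (((sameCycle_sumCongr_inr f g).2 hx.symm).swap_mul hn))
  have h₂ := cycleCount_swap_mul_of_not_sameCycle (not_sameCycle_swap_mul_swap_mul_sumCongr f g d x
    (.inr ⟨hx', fun h => hx' (h.trans hx)⟩))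
  rw [crossSwap_mul]
  omega

end Sum

end Equiv.Perm

/-! ### Rotation systems and faces of `H3` -/

namespace MultiGraph

/-- The edge-ends of `H3`. -/
abbrev H3End : Type := ((Fin 3 × Fin 2) ⊕ Fin 3) × Bool

/-- The end of the `i`-th free edge of `H3` at its free node. -/
def freeEnd (i : Fin 3) : H3End := (Sum.inr i, false)

theorem freeEnd_injective : freeEnd.Injective := fun i j h => by simpa [freeEnd] using h

/-- The successor function of a rotation system of `H3`, where `a` and `b` choose one of the two
cyclic orders at each trivalent vertex. -/
def h3Next (a : Fin 3 → Bool) (b : Fin 2 → Bool) : H3End → H3End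
  | (Sum.inl (i, j), false) => if a i = decide (j = 0) then (Sum.inl (i, j + 1), false)
      else (Sum.inr i, true)
  | (Sum.inr i, true) => (Sum.inl (i, if a i then 0 else 1), false)
  | (Sum.inl (i, j), true) => (Sum.inl (i + if b j then 1 else 2, j), true)
  | (Sum.inr i, false) => (Sum.inr i, false)

theorem h3Next_h3Next (a : Fin 3 → Bool) (b : Fin 2 → Bool) (z : H3End) :
    h3Next a b (h3Next (fun i => !a i) (fun j => !b j) z) = z := by
  obtain ⟨⟨i, j⟩ | i, _ | _⟩ := z
  · cases h : a i <;> fin_cases j <;> simp [h3Next, h]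
  · cases h : b j <;> fin_cases i <;> simp [h3Next, h]
  · simp [h3Next]
  · cases h : a i <;> simp [h3Next, h]

/-- The rotation system of `H3` with the cyclic orders chosen by `a` and `b`, as a permutation. -/
def h3Rot (a : Fin 3 → Bool) (b : Fin 2 → Bool) : Equiv.Perm H3End where
  toFun := h3Next a b
  invFun := h3Next (fun i => !a i) (fun j => !b j)
  left_inv z := by simpa using h3Next_h3Next (fun i => !a i) (fun j => !b j) z
  right_inv := h3Next_h3Next a b

/-- Face tracing for the rotation system `h3Rot a b`. -/
def h3Face (a : Fin 3 → Bool) (b : Fin 2 → Bool) : Equiv.Perm H3End :=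
  (Equiv.prodCongr (Equiv.refl _) Equiv.boolNot).trans (h3Rot a b)

/-- The amount by which the rotation at the `j`-th hub of `H3` shifts its ends. -/
def hubShift (b : Fin 2 → Bool) (j : Fin 2) : Fin 3 := if b j then 1 else 2

section

variable (a : Fin 3 → Bool) (b : Fin 2 → Bool)

theorem sameCycle_h3Face_apply {y z : H3End} (h : h3Face a b y = z) :
    (h3Face a b).SameCycle y z :=
  h ▸ Equiv.Perm.sameCycle_apply_right.2 (.refl _ _)

theorem h3Face_apply (y : H3End) : h3Face a b y = h3Next a b (y.1, !y.2) := rfl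

theorem sameCycle_hub_arm (i : Fin 3) : (h3Face a b).SameCycle (Sum.inl (i, 0), true)
    (Sum.inl (i, 1), false) := by
  cases h : a i
  · refine (sameCycle_h3Face_apply a b (z := (Sum.inr i, true)) ?_).trans
      ((sameCycle_h3Face_apply a b (z := (Sum.inr i, false)) ?_).trans
        (sameCycle_h3Face_apply a b ?_)) <;> simp [h3Face_apply, h3Next, h]
  · exact sameCycle_h3Face_apply a b (by simp [h3Face_apply, h3Next, h])

theorem sameCycle_hub_arm' (i : Fin 3) : (h3Face a b).SameCycle (Sum.inl (i, 1), true)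
    (Sum.inl (i, 0), false) := by
  cases h : a i
  · exact sameCycle_h3Face_apply a b (by simp [h3Face_apply, h3Next, h])
  · refine (sameCycle_h3Face_apply a b (z := (Sum.inr i, true)) ?_).trans
      ((sameCycle_h3Face_apply a b (z := (Sum.inr i, false)) ?_).trans
        (sameCycle_h3Face_apply a b ?_)) <;> simp [h3Face_apply, h3Next, h]

theorem sameCycle_arm_hub (i : Fin 3) (j : Fin 2) : (h3Face a b).SameCycle
    (Sum.inl (i, j), false) (Sum.inl (i + hubShift b j, j), true) :=
  sameCycle_h3Face_apply a b (by simp [h3Face_apply, h3Next, hubShift])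

/-- Going along the arms from hub 0 to hub 1 and back shifts the index by the sum of the two hub
shifts. The sum is zero exactly when the hubs have opposite orientations; otherwise it generates
`Fin 3`. -/
theorem sameCycle_hub_hub (i : Fin 3) : (h3Face a b).SameCycle (Sum.inl (i, 0), true)
    (Sum.inl (i + (hubShift b 1 + hubShift b 0), 0), true) := by
  rw [← add_assoc]
  exact (((sameCycle_hub_arm a b i).trans (sameCycle_arm_hub a b i 1)).trans
    (sameCycle_hub_arm' a b _)).trans (sameCycle_arm_hub a b _ 0)

theorem sameCycle_freeEnd (i : Fin 3) : (h3Face a b).SameCycle (freeEnd i)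
    (Sum.inl (i, if a i then 0 else 1), false) :=
  sameCycle_h3Face_apply a b (by simp [h3Face_apply, h3Next, freeEnd])

/-- Every face passes through hub 0, which bounds the number of faces by three. -/
theorem exists_sameCycle_h3Face (z : H3End) :
    ∃ i : Fin 3, (h3Face a b).SameCycle (Sum.inl (i, 0), true) z := by
  have harm : ∀ i j, ∃ k : Fin 3, (h3Face a b).SameCycle (Sum.inl (k, 0), true)
      (Sum.inl (i, j), false) := by
    intro i j
    fin_cases j
    · exact ⟨_, (sameCycle_arm_hub a b i 0).symm⟩
    · exact ⟨i, sameCycle_hub_arm a b i⟩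
  have hfree : ∀ i, ∃ k : Fin 3, (h3Face a b).SameCycle (Sum.inl (k, 0), true) (freeEnd i) := by
    intro i
    obtain ⟨k, hk⟩ := harm i (if a i then 0 else 1)
    exact ⟨k, hk.trans (sameCycle_freeEnd a b i).symm⟩
  obtain ⟨⟨i, j⟩ | i, _ | _⟩ := z
  · exact harm i j
  · fin_cases j
    · exact ⟨i, .refl _ _⟩
    · obtain ⟨k, hk⟩ := harm i 0
      exact ⟨k, hk.trans (sameCycle_hub_arm' a b i).symm⟩
  · exact hfree i
  · obtain ⟨k, hk⟩ := hfree i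
    exact ⟨k, hk.trans (sameCycle_h3Face_apply a b (by simp [h3Face_apply, h3Next, freeEnd])).symm⟩

/-- The label of the face that contains an edge-end, when the two hubs of `H3` have opposite
orientations. -/
def faceLabel : H3End → Fin 3
  | (Sum.inl (i, j), true) => if j = 0 then i else i + hubShift b 0
  | (Sum.inl (i, j), false) => if j = 0 then i + hubShift b 0 else i
  | (Sum.inr i, _) => if a i then i + hubShift b 0 else i

theorem faceLabel_h3Face (hb : hubShift b 1 + hubShift b 0 = 0) (z : H3End) :
    faceLabel a b (h3Face a b z) = faceLabel a b z := by
  obtain ⟨⟨i, j⟩ | i, _ | _⟩ := z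
  · have h : h3Face a b (Sum.inl (i, j), false) = (Sum.inl (i + hubShift b j, j), true) := rfl
    rw [h]
    fin_cases j <;> simp [faceLabel, add_assoc, hb]
  all_goals cases h : a i
  · fin_cases j <;> simp [h3Face_apply, h3Next, faceLabel, h]
  · fin_cases j <;> simp [h3Face_apply, h3Next, faceLabel, h]
  all_goals simp [h3Face_apply, h3Next, faceLabel, h]

theorem faceLabel_eq (hb : hubShift b 1 + hubShift b 0 = 0) {y z : H3End}
    (h : (h3Face a b).SameCycle y z) : faceLabel a b y = faceLabel a b z :=
  h.eq_of_invariant (faceLabel_h3Face a b hb)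

/-- If all free edges of `H3` lie in one face, then the embedding has only one face. -/
theorem sameCycle_h3Face_of_freeEnd
    (h₁ : (h3Face a b).SameCycle (freeEnd 1) (freeEnd 0))
    (h₂ : (h3Face a b).SameCycle (freeEnd 2) (freeEnd 0)) (i : Fin 3) :
    (h3Face a b).SameCycle (Sum.inl (0, 0), true) (Sum.inl (i, 0), true) := by
  -- In the planar case the `i`-th free edge has label `i` or `i + hubShift b 0`, and no label is
  -- available to all three. Otherwise the shift permutes the ends at hub 0 cyclically.
  by_cases hb : hubShift b 1 + hubShift b 0 = 0
  · have e₁ := faceLabel_eq a b hb h₁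
    have e₂ := faceLabel_eq a b hb h₂
    simp only [faceLabel, freeEnd, hubShift] at e₁ e₂
    generalize a 0 = a₀ at *
    generalize a 1 = a₁ at *
    generalize a 2 = a₂ at *
    generalize b 0 = b₀ at *
    exfalso
    clear * - e₁ e₂
    revert a₀ a₁ a₂ b₀
    decide
  · have h := sameCycle_hub_hub a b
    generalize hubShift b 1 + hubShift b 0 = s at *
    have hs : i = 0 ∨ i = 0 + s ∨ i = 0 + s + s := by
      clear * - hb
      revert i s
      decide
    rcases hs with rfl | rfl | rfl
    · exact .refl _ _
    · exact h 0
    · exact (h 0).trans (h _)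

end

theorem exists_planar_h3Face (k : Fin 3) : ∃ a b,
    (h3Face a b).SameCycle (freeEnd (k + 1)) (freeEnd (k + 2)) ∧
    ¬ (h3Face a b).SameCycle (freeEnd k) (freeEnd (k + 2)) ∧
    ∀ i j : Fin 3, (h3Face a b).SameCycle (Sum.inl (i, 0), true) (Sum.inl (j, 0), true) →
      i = j := by
  -- Here `hubShift b 0 = 1`, so turning only arm `k + 1` moves its free edge to label `k + 2`,
  -- which arm `k + 2` already has, while arm `k` keeps label `k`.
  let a : Fin 3 → Bool := fun i => decide (i = k + 1)
  let b : Fin 2 → Bool := ![true, false]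
  have hb : hubShift b 1 + hubShift b 0 = 0 := by decide
  have ha : a (k + 1) = true ∧ a (k + 2) = false ∧ a k = false := by revert k; decide
  refine ⟨a, b, ?_, fun h => ?_, fun i j h => by simpa [faceLabel] using faceLabel_eq a b hb h⟩
  · have h₁ := sameCycle_freeEnd a b (k + 1)
    have h₂ := sameCycle_freeEnd a b (k + 2)
    rw [ha.1] at h₁
    rw [ha.2.1] at h₂
    have e : k + 1 + hubShift b 0 = k + 2 := by rw [add_assoc]; rfl
    have h₃ := sameCycle_arm_hub a b (k + 1) 0
    rw [e] at h₃
    exact (h₁.trans h₃).trans ((sameCycle_hub_arm a b (k + 2)).trans h₂.symm)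
  · have := faceLabel_eq a b hb h
    simp [faceLabel, freeEnd, ha] at this

/-- The map that sends an edge-end at a vertex of degree three of `H3` to its face. -/
def hubFace (a : Fin 3 → Bool) (b : Fin 2 → Bool) (i : Fin 3) :
    Quotient (Equiv.Perm.SameCycle.setoid (h3Face a b)) :=
  Quotient.mk _ (Sum.inl (i, 0), true)

theorem hubFace_surjective (a : Fin 3 → Bool) (b : Fin 2 → Bool) :
    (hubFace a b).Surjective := by
  rintro ⟨z⟩
  obtain ⟨i, hi⟩ := exists_sameCycle_h3Face a b z
  exact ⟨i, Quotient.sound (s := Equiv.Perm.SameCycle.setoid (h3Face a b)) hi⟩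

theorem cycleCount_h3Face_le (a : Fin 3 → Bool) (b : Fin 2 → Bool) :
    (h3Face a b).cycleCount ≤ 3 := by
  simpa [Equiv.Perm.cycleCount] using Nat.card_le_card_of_surjective _ (hubFace_surjective a b)

theorem cycleCount_h3Face_le_one (a : Fin 3 → Bool) (b : Fin 2 → Bool)
    (h₁ : (h3Face a b).SameCycle (freeEnd 1) (freeEnd 0))
    (h₂ : (h3Face a b).SameCycle (freeEnd 2) (freeEnd 0)) :
    (h3Face a b).cycleCount ≤ 1 := by
  have hconst : ∀ i, hubFace a b 0 = hubFace a b i := fun i =>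
    Quotient.sound (s := Equiv.Perm.SameCycle.setoid (h3Face a b))
      (sameCycle_h3Face_of_freeEnd a b h₁ h₂ i)
  have hs : Function.Surjective fun _ : Unit => hubFace a b 0 := by
    intro c
    obtain ⟨i, rfl⟩ := hubFace_surjective a b c
    exact ⟨(), hconst i⟩
  simpa [Equiv.Perm.cycleCount] using Nat.card_le_card_of_surjective _ hs

/-- For each `k`, some planar rotation system of `H3` has the two free edges other than the `k`-th
in a common face that does not contain the `k`-th free edge. -/
theorem exists_h3Face_cycleCount_eq (k : Fin 3) : ∃ a b,
    (h3Face a b).SameCycle (freeEnd (k + 1)) (freeEnd (k + 2)) ∧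
    ¬ (h3Face a b).SameCycle (freeEnd k) (freeEnd (k + 2)) ∧ (h3Face a b).cycleCount = 3 := by
  obtain ⟨a, b, h₁, h₂, h₃⟩ := exists_planar_h3Face k
  refine ⟨a, b, h₁, h₂, (cycleCount_h3Face_le a b).antisymm ?_⟩
  have hinj : (hubFace a b).Injective := fun i j h =>
    h₃ i j (Quotient.exact (s := Equiv.Perm.SameCycle.setoid (h3Face a b)) h)
  simpa [Equiv.Perm.cycleCount] using Nat.card_le_card_of_injective _ hinj

end MultiGraph

/-! ### Edge-ends and rotations of the glued graph -/

theorem Equiv.Perm.SameCycle.eq_of_apply_eq_self {γ : Type*} {p : Equiv.Perm γ} {z z' : γ}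
    (h : p.SameCycle z z') (hz : p z = z) : z = z' := by
  have hq : ∀ x, (p x = z) = (x = z) := fun x => by
    conv_lhs => rw [← hz, p.injective.eq_iff]
  exact ((h.eq_of_invariant (q := fun x => x = z) hq).mp (Eq.refl z)).symm

theorem Equiv.Perm.eq_three_cycle {γ : Type*} [Finite γ] {p : Equiv.Perm γ} {u v w : γ}
    (huv : u ≠ v) (huw : u ≠ w) (hvw : v ≠ w)
    (h : ∀ z, p.SameCycle u z ↔ z = u ∨ z = v ∨ z = w) :
    (p u = v ∧ p v = w ∧ p w = u) ∨ (p u = w ∧ p w = v ∧ p v = u) := by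
  have fixed : ∀ {z z'}, p z = z → p.SameCycle z z' → z = z' := fun hz hs =>
    hs.eq_of_apply_eq_self hz
  have hv := (h v).2 (by simp)
  have hw := (h w).2 (by simp)
  have mu := (h (p u)).1 (Equiv.Perm.sameCycle_apply_right.2 (.refl _ _))
  have mv := (h (p v)).1 (Equiv.Perm.sameCycle_apply_right.2 hv)
  have mw := (h (p w)).1 (Equiv.Perm.sameCycle_apply_right.2 hw)
  have nu : p u ≠ u := fun e => huv (fixed e hv)
  have nv : p v ≠ v := fun e => huv (fixed e hv.symm).symm
  have nw : p w ≠ w := fun e => huw (fixed e hw.symm).symm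
  have iuv := p.injective.ne huv
  have iuw := p.injective.ne huw
  have ivw := p.injective.ne hvw
  grind

namespace MultiGraph

variable {V E : Type*}

/-- The edge-ends of an attached graph are those of its two parts. -/
def attachEnds (E F : Type*) : (E × Bool) ⊕ (F × Bool) ≃ (E ⊕ F) × Bool :=
  (Equiv.sumProdDistrib E F Bool).symm

theorem attachEnds_inr {E F : Type*} (d : F × Bool) :
    attachEnds E F (Sum.inr d) = (Sum.inr d.1, d.2) := rfl

theorem vert_attach_inl {B C F : Type*} (G : MultiGraph V E) (H : MultiGraph (B ⊕ C) F)
    (t : B → V) (d : E × Bool) :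
    (G.attach H t).vert (attachEnds E F (Sum.inl d)) = Sum.inl (G.vert d) := rfl

theorem vert_attach_inr {B C F : Type*} (G : MultiGraph V E) (H : MultiGraph (B ⊕ C) F)
    (t : B → V) (d : F × Bool) :
    (G.attach H t).vert (attachEnds E F (Sum.inr d)) = Sum.map t id (H.vert d) := rfl

theorem H3_vert_eq_inl {z : H3End} {i : Fin 3} (h : H3.vert z = Sum.inl i) : z = freeEnd i := by
  obtain ⟨⟨i, j⟩ | i, _ | _⟩ := z <;> simp_all [H3, freeEnd]

theorem H3_vert_h3Rot (a : Fin 3 → Bool) (b : Fin 2 → Bool) (z : H3End) :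
    H3.vert (h3Rot a b z) = H3.vert z := by
  obtain ⟨⟨i, j⟩ | i, _ | _⟩ := z
  · by_cases h : a i = decide (j = 0) <;> simp [H3, h3Rot, h3Next, h]
  all_goals rfl

theorem sameCycle_h3Rot_apply (a : Fin 3 → Bool) (b : Fin 2 → Bool) {y z : H3End}
    (h : h3Rot a b y = z) : (h3Rot a b).SameCycle y z :=
  h ▸ Equiv.Perm.sameCycle_apply_right.2 (.refl _ _)

theorem sameCycle_h3Rot_arm (a : Fin 3 → Bool) (b : Fin 2 → Bool) (i : Fin 3) (j : Fin 2) :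
    (h3Rot a b).SameCycle (Sum.inl (i, j), false) (Sum.inr i, true) := by
  by_cases h : a i = decide (j = 0)
  · refine (sameCycle_h3Rot_apply a b (z := (Sum.inl (i, j + 1), false)) ?_).trans
      (sameCycle_h3Rot_apply a b ?_)
    · simp [h3Rot, h3Next, h]
    · fin_cases j <;> simp_all [h3Rot, h3Next]
  · exact sameCycle_h3Rot_apply a b (by simp [h3Rot, h3Next, h])

theorem sameCycle_h3Rot_hub (a : Fin 3 → Bool) (b : Fin 2 → Bool) (i i' : Fin 3) (j : Fin 2) :
    (h3Rot a b).SameCycle (Sum.inl (i, j), true) (Sum.inl (i', j), true) := by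
  have h : ∀ i, (h3Rot a b).SameCycle (Sum.inl (i, j), true)
      (Sum.inl (i + hubShift b j, j), true) := fun i => sameCycle_h3Rot_apply a b rfl
  have hs : ∀ c : Bool, ∀ i i' : Fin 3, i' = i ∨ i' = i + (if c then 1 else 2) ∨
      i' = i + (if c then 1 else 2) + (if c then 1 else 2) := by decide
  rcases hs (b j) i i' with rfl | rfl | rfl
  · exact .refl _ _
  · exact h i
  · exact (h i).trans (h _)

theorem sameCycle_h3Rot_of_vert_eq (a : Fin 3 → Bool) (b : Fin 2 → Bool) {y z : H3End}
    (h : H3.vert y = H3.vert z) : (h3Rot a b).SameCycle y z := by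
  obtain ⟨⟨i, j⟩ | i, _ | _⟩ := y <;> obtain ⟨⟨i', j'⟩ | i', _ | _⟩ := z <;>
    simp only [H3, Sum.inr.injEq, Sum.inl.injEq, reduceCtorEq] at h <;> subst h
  · exact (sameCycle_h3Rot_arm a b i j).trans (sameCycle_h3Rot_arm a b i j').symm
  · exact sameCycle_h3Rot_arm a b i j
  · exact sameCycle_h3Rot_hub a b i i' j
  · exact .refl _ _
  · exact (sameCycle_h3Rot_arm a b i j').symm
  · exact .refl _ _

theorem vert_eq_map_H3_vert {t : Fin 3 → V} {v : V} {z : H3End}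
    (h : Sum.map t id (H3.vert z) = Sum.inl v) : ∃ i, z = freeEnd i ∧ t i = v := by
  cases hz : H3.vert z with
  | inl i =>
    rw [hz] at h
    exact ⟨i, H3_vert_eq_inl hz, Sum.inl.inj h⟩
  | inr c => simp [hz] at h

namespace Rotation

variable {G : MultiGraph V E} {t : Fin 3 → V}

theorem vert_next (P : G.Rotation) (d : E × Bool) : G.vert (P.next d) = G.vert d :=
  (P.sameCycle_iff _ _).1 (Equiv.Perm.sameCycle_apply_left.2 (.refl _ _))

variable [DecidableEq E]

/-- The rotation of `G.attach H3 t` that comes from inserting the `i`-th free edge of `H3` in front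
of the edge-end `d i`, for each `i`, on the level of permutations. -/
def insertNext (P : G.Rotation) (d : Fin 3 → E × Bool) (a : Fin 3 → Bool) (b : Fin 2 → Bool) :
    Equiv.Perm ((E ⊕ ((Fin 3 × Fin 2) ⊕ Fin 3)) × Bool) :=
  (attachEnds _ _).permCongr
    (Equiv.Perm.crossSwap d freeEnd * Equiv.Perm.sumCongr P.next (h3Rot a b))

theorem insertNext_apply (P : G.Rotation) (d : Fin 3 → E × Bool) (a : Fin 3 → Bool)
    (b : Fin 2 → Bool) (z : (E × Bool) ⊕ H3End) :
    P.insertNext d a b (attachEnds _ _ z) = attachEnds _ _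
      (Equiv.Perm.crossSwap d freeEnd (Equiv.Perm.sumCongr P.next (h3Rot a b) z)) := by
  simp [insertNext]

/-- Face tracing reverses the edge and then applies the rotation. Reversal preserves both summands,
so the factor `crossSwap` stays on the left and only the two rotations turn into face permutations.
-/
theorem card_face_of_next_eq (P : G.Rotation) (d : Fin 3 → E × Bool) (a : Fin 3 → Bool)
    (b : Fin 2 → Bool) (Q : (G.attach H3 t).Rotation) (hQ : Q.next = P.insertNext d a b) :
    Nat.card Q.Face = (Equiv.Perm.crossSwap d freeEnd *
      Equiv.Perm.sumCongr P.faceStep (h3Face a b)).cycleCount := by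
  have : Q.faceStep = (attachEnds _ _).permCongr (Equiv.Perm.crossSwap d freeEnd *
      Equiv.Perm.sumCongr P.faceStep (h3Face a b)) := by
    ext1 z
    obtain ⟨z, rfl⟩ := (attachEnds _ _).surjective z
    rw [faceStep, hQ]
    rcases z with z | z
    · exact (P.insertNext_apply d a b (Sum.inl (z.1, !z.2))).trans (by simp [faceStep]; rfl)
    · exact (P.insertNext_apply d a b (Sum.inr (z.1, !z.2))).trans (by simp [h3Face]; rfl)
  rw [← Equiv.Perm.cycleCount_permCongr (attachEnds _ _), ← this]
  rfl

theorem eulerChar_of_next_eq [Finite V] [Finite E] (P : G.Rotation) (d : Fin 3 → E × Bool)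
    -- The constant 4 below is 9 new edges minus 5 new vertices.
    (a : Fin 3 → Bool) (b : Fin 2 → Bool) (Q : (G.attach H3 t).Rotation)
    (hQ : Q.next = P.insertNext d a b) :
    Q.eulerChar = P.eulerChar - 4 - P.faceStep.cycleCount + (Equiv.Perm.crossSwap d freeEnd *
      Equiv.Perm.sumCongr P.faceStep (h3Face a b)).cycleCount := by
  rw [eulerChar, P.card_face_of_next_eq d a b Q hQ, eulerChar,
    show Nat.card P.Face = P.faceStep.cycleCount from rfl, Nat.card_sum, Nat.card_sum]
  simp
  ring

variable [Finite E]

/-- The `d i` sit at distinct vertices, so in the rotation each transposition merges the cycle at `t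
i` with the fixed point `freeEnd i`; the resulting cycles are those of the glued vertices. -/
theorem exists_extension (P : G.Rotation) (ht : t.Injective) {d : Fin 3 → E × Bool}
    (hd : ∀ i, G.vert (d i) = t i) (a : Fin 3 → Bool) (b : Fin 2 → Bool) :
    ∃ Q : (G.attach H3 t).Rotation, Q.Extends P ∧ Q.next = P.insertNext d a b := by
  have hdi : d.Injective := fun i j h => ht (by rw [← hd, ← hd, h])
  have hds : ∀ i j, i ≠ j → ¬ P.next.SameCycle (d i) (d j) := fun i j hij h =>
    hij (ht (by rw [← hd, ← hd]; exact (P.sameCycle_iff _ _).1 h))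
  have h₀ : ¬ (Equiv.Perm.sumCongr P.next (h3Rot a b)).SameCycle (Sum.inl (d 0))
      (Sum.inr (freeEnd 0)) := Equiv.Perm.not_sameCycle_sumCongr _ _
  have h₁ := Equiv.Perm.not_sameCycle_swap_mul_sumCongr P.next (h3Rot a b) d freeEnd
    fun h => hds 1 0 (by decide) h.1
  have h₂ := Equiv.Perm.not_sameCycle_swap_mul_swap_mul_sumCongr P.next (h3Rot a b) d freeEnd
    (.inl ⟨hds 2 0 (by decide), hds 2 1 (by decide)⟩)
  have hmono : ∀ {y z}, (Equiv.Perm.sumCongr P.next (h3Rot a b)).SameCycle y z →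
      (Equiv.Perm.crossSwap d freeEnd * Equiv.Perm.sumCongr P.next (h3Rot a b)).SameCycle y z := by
    intro y z h
    rw [Equiv.Perm.crossSwap_mul]
    exact ((h.swap_mul h₀).swap_mul h₁).swap_mul h₂
  have hjoin : ∀ i, (Equiv.Perm.crossSwap d freeEnd *
      Equiv.Perm.sumCongr P.next (h3Rot a b)).SameCycle (Sum.inl (d i)) (Sum.inr (freeEnd i)) := by
    intro i
    rw [Equiv.Perm.crossSwap_mul]
    fin_cases i
    · exact ((Equiv.Perm.sameCycle_swap_mul h₀).swap_mul h₁).swap_mul h₂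
    · exact (Equiv.Perm.sameCycle_swap_mul h₁).swap_mul h₂
    · exact Equiv.Perm.sameCycle_swap_mul h₂
  have hinl : ∀ {x y}, G.vert x = G.vert y → (Equiv.Perm.crossSwap d freeEnd *
      Equiv.Perm.sumCongr P.next (h3Rot a b)).SameCycle (Sum.inl x) (Sum.inl y) := fun h =>
    hmono ((Equiv.Perm.sameCycle_sumCongr_inl _ _).2 ((P.sameCycle_iff _ _).2 h))
  have hcross : ∀ {x : E × Bool} {z : H3End}, Sum.inl (G.vert x) = Sum.map t id (H3.vert z) →
      (Equiv.Perm.crossSwap d freeEnd * Equiv.Perm.sumCongr P.next (h3Rot a b)).SameCycle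
        (Sum.inl x) (Sum.inr z) := by
    intro x z h
    obtain ⟨i, rfl, hi⟩ := vert_eq_map_H3_vert h.symm
    exact (hinl (by rw [hd, hi])).trans (hjoin i)
  refine ⟨⟨P.insertNext d a b, fun y z => ?_⟩, fun x => ?_, rfl⟩
  · obtain ⟨y, rfl⟩ := (attachEnds _ _).surjective y
    obtain ⟨z, rfl⟩ := (attachEnds _ _).surjective z
    rw [insertNext, Equiv.Perm.sameCycle_permCongr]
    constructor
    · intro h
      rw [Equiv.Perm.crossSwap_mul] at h
      let q : (E × Bool) ⊕ H3End → V ⊕ (Fin 3 ⊕ Fin 2) :=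
        fun z => (G.attach H3 t).vert (attachEnds _ _ z)
      have hv : ∀ i, q (Sum.inl (d i)) = q (Sum.inr (freeEnd i)) := fun i =>
        congrArg Sum.inl (hd i)
      refine h.eq_of_invariant (q := q) (Equiv.Perm.invariant_swap_mul (Equiv.Perm.invariant_swap_mul
          (Equiv.Perm.invariant_swap_mul ?_ (hv 0)) (hv 1)) (hv 2))
      rintro (x | x)
      · exact congrArg Sum.inl (P.vert_next x)
      · exact congrArg (Sum.map t id) (H3_vert_h3Rot a b x)
    · intro h
      rcases y with x | y <;> rcases z with x' | z
      · exact hinl (Sum.inl.inj h)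
      · exact hcross h
      · exact (hcross h.symm).symm
      · exact hmono ((Equiv.Perm.sameCycle_sumCongr_inr _ _).2 (sameCycle_h3Rot_of_vert_eq a b
          (Sum.map_injective.2 ⟨ht, Function.injective_id⟩ h)))
  · have hx := P.insertNext_apply d a b (Sum.inl x)
    -- If a free edge was inserted in front of `P.next x`, two steps are needed, passing through
    -- `freeEnd i`; otherwise one.
    by_cases hp : ∃ i, d i = P.next x
    · obtain ⟨i, hi⟩ := hp
      have hfix : h3Rot a b (freeEnd i) = freeEnd i := rfl
      have hy := P.insertNext_apply d a b (Sum.inr (freeEnd i))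
      rw [Equiv.Perm.sumCongr_apply, Sum.map_inl, ← hi,
        Equiv.Perm.crossSwap_inl hdi freeEnd_injective] at hx
      rw [Equiv.Perm.sumCongr_apply, Sum.map_inr, hfix,
        Equiv.Perm.crossSwap_inr hdi freeEnd_injective, hi] at hy
      refine ⟨2, by norm_num, ?_, fun m hm hm' x' => ?_⟩
      · rw [pow_two, Equiv.Perm.mul_apply]
        exact (congrArg _ hx).trans hy
      · obtain rfl : m = 1 := by omega
        rw [pow_one]
        exact fun h => by simpa [attachEnds_inr] using hx.symm.trans h
    · push Not at hp
      rw [Equiv.Perm.sumCongr_apply, Sum.map_inl, Equiv.Perm.crossSwap_inl_of_ne hp] at hx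
      exact ⟨1, by norm_num, by rw [pow_one]; exact hx, fun m hm hm' => by omega⟩

end Rotation

end MultiGraph

/-! ### Every extension arises by insertion -/

namespace MultiGraph

namespace Rotation

variable {V E : Type*} {G : MultiGraph V E} {t : Fin 3 → V}

section
variable (Q : (G.attach H3 t).Rotation)

theorem exists_next_freeEnd (ht : t.Injective) (hdeg : ∀ i, ∃ d, G.vert d = t i) (i : Fin 3) :
    ∃ d, G.vert d = t i ∧
      Q.next (attachEnds _ _ (Sum.inr (freeEnd i))) = attachEnds _ _ (Sum.inl d) := by
  have hv := Q.vert_next (attachEnds _ _ (Sum.inr (freeEnd i)))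
  obtain ⟨z, hz⟩ := (attachEnds _ _).surjective (Q.next (attachEnds _ _ (Sum.inr (freeEnd i))))
  rw [← hz] at hv
  rcases z with d | z
  · exact ⟨d, Sum.inl.inj hv, hz.symm⟩
  -- The only end of `H3` at `t i` is `freeEnd i` itself; it cannot be fixed, since an end of `G`
  -- shares its cycle.
  · obtain ⟨j, rfl, hj⟩ := vert_eq_map_H3_vert (v := t i) (z := z) hv
    obtain rfl := ht hj
    obtain ⟨x, hx⟩ := hdeg j
    have hs : Q.next.SameCycle (attachEnds _ _ (Sum.inr (freeEnd j)))
        (attachEnds _ _ (Sum.inl x)) :=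
      (Q.sameCycle_iff _ _).2 (congrArg Sum.inl hx.symm)
    have := Equiv.Perm.SameCycle.eq_of_apply_eq_self hs hz.symm
    simp at this

variable [Finite E]

theorem next_attachEnds_inr_armVertex (i : Fin 3) : ∃ c : Bool, ∀ a b, a i = c → ∀ z : H3End,
    H3.vert z = Sum.inr (Sum.inl i) →
      Q.next (attachEnds _ _ (Sum.inr z)) = attachEnds _ _ (Sum.inr (h3Rot a b z)) := by
  have key := Equiv.Perm.eq_three_cycle (p := Q.next)
    (u := attachEnds E _ (Sum.inr (Sum.inl (i, 0), false)))
    (v := attachEnds E _ (Sum.inr (Sum.inl (i, 1), false)))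
    (w := attachEnds E _ (Sum.inr (Sum.inr i, true))) (by simp) (by simp) (by simp) (by
      intro z
      obtain ⟨z, rfl⟩ := (attachEnds _ _).surjective z
      rw [Q.sameCycle_iff, vert_attach_inr]
      obtain x | ⟨⟨i', j⟩ | i', _ | _⟩ := z
      · rw [vert_attach_inl]; simp [H3]
      all_goals rw [vert_attach_inr]; simp [H3, eq_comm]
      fin_cases j <;> simp)
  have hz : ∀ z, H3.vert z = Sum.inr (Sum.inl i) → z = (Sum.inl (i, 0), false) ∨
      z = (Sum.inl (i, 1), false) ∨ z = (Sum.inr i, true) := by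
    rintro ⟨⟨i', j⟩ | i', _ | _⟩ <;> simp [H3]
    rintro rfl
    fin_cases j <;> simp
  rcases key with ⟨h₁, h₂, h₃⟩ | ⟨h₁, h₂, h₃⟩
  · refine ⟨true, fun a b ha z hv => ?_⟩
    rcases hz z hv with rfl | rfl | rfl
    · rw [h₁]; simp [h3Rot, h3Next, ha]
    · rw [h₂]; simp [h3Rot, h3Next, ha]
    · rw [h₃]; simp [h3Rot, h3Next, ha]
  · refine ⟨false, fun a b ha z hv => ?_⟩
    rcases hz z hv with rfl | rfl | rfl
    · rw [h₁]; simp [h3Rot, h3Next, ha]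
    · rw [h₃]; simp [h3Rot, h3Next, ha]
    · rw [h₂]; simp [h3Rot, h3Next, ha]

theorem next_attachEnds_inr_hubVertex (j : Fin 2) : ∃ c : Bool, ∀ a b, b j = c → ∀ z : H3End,
    H3.vert z = Sum.inr (Sum.inr j) →
      Q.next (attachEnds _ _ (Sum.inr z)) = attachEnds _ _ (Sum.inr (h3Rot a b z)) := by
  have key := Equiv.Perm.eq_three_cycle (p := Q.next)
    (u := attachEnds E _ (Sum.inr (Sum.inl (0, j), true)))
    (v := attachEnds E _ (Sum.inr (Sum.inl (1, j), true)))
    (w := attachEnds E _ (Sum.inr (Sum.inl (2, j), true))) (by simp) (by simp) (by simp) (by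
      intro z
      obtain ⟨z, rfl⟩ := (attachEnds _ _).surjective z
      rw [Q.sameCycle_iff, vert_attach_inr]
      obtain x | ⟨⟨i, j'⟩ | i', _ | _⟩ := z
      · rw [vert_attach_inl]; simp [H3]
      all_goals rw [vert_attach_inr]; simp [H3, eq_comm]
      fin_cases i <;> simp)
  have hz : ∀ z, H3.vert z = Sum.inr (Sum.inr j) → z = (Sum.inl (0, j), true) ∨
      z = (Sum.inl (1, j), true) ∨ z = (Sum.inl (2, j), true) := by
    rintro ⟨⟨i, j'⟩ | i', _ | _⟩ <;> simp [H3]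
    rintro rfl
    fin_cases i <;> simp
  rcases key with ⟨h₁, h₂, h₃⟩ | ⟨h₁, h₂, h₃⟩
  · refine ⟨true, fun a b hb z hv => ?_⟩
    rcases hz z hv with rfl | rfl | rfl
    · rw [h₁]; simp [h3Rot, h3Next, hb]
    · rw [h₂]; simp [h3Rot, h3Next, hb]
    · rw [h₃]; simp [h3Rot, h3Next, hb]
  · refine ⟨false, fun a b hb z hv => ?_⟩
    rcases hz z hv with rfl | rfl | rfl
    · rw [h₁]; simp [h3Rot, h3Next, hb]
    · rw [h₃]; simp [h3Rot, h3Next, hb]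
    · rw [h₂]; simp [h3Rot, h3Next, hb]

end

/-- An end of `H3` following `x` must be some `freeEnd i`, whose successor `d i` is in `G`. Thus the
first return to `G` takes at most two steps, and `Extends` identifies it with `P.next x`. -/
theorem next_attachEnds_inl {P : G.Rotation} {Q : (G.attach H3 t).Rotation} (hQ : Q.Extends P)
    {d : Fin 3 → E × Bool}
    (hd : ∀ i, Q.next (attachEnds _ _ (Sum.inr (freeEnd i))) = attachEnds _ _ (Sum.inl (d i)))
    (x : E × Bool) :
    (Q.next (attachEnds _ _ (Sum.inl x)) = attachEnds _ _ (Sum.inl (P.next x)) ∧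
      ∀ i, d i ≠ P.next x) ∨
    ∃ i, d i = P.next x ∧
      Q.next (attachEnds _ _ (Sum.inl x)) = attachEnds _ _ (Sum.inr (freeEnd i)) := by
  obtain ⟨n, hn, hret, hmin⟩ := hQ x
  obtain ⟨z, hz⟩ := (attachEnds _ _).surjective (Q.next (attachEnds _ _ (Sum.inl x)))
  rcases z with y | z
  · obtain rfl : n = 1 := by
      by_contra hne
      exact hmin 1 one_pos (by omega) y hz.symm
    left
    refine ⟨hret, fun i hi => ?_⟩
    have h := (hd i).trans ((congrArg (fun y => attachEnds _ _ (Sum.inl y)) hi).trans hret.symm)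
    exact Sum.inr_ne_inl ((attachEnds _ _).injective (Q.next.injective h))
  · have hv := Q.vert_next (attachEnds _ _ (Sum.inl x))
    rw [← hz] at hv
    obtain ⟨i, rfl, -⟩ := vert_eq_map_H3_vert (v := G.vert x) (z := z) hv
    refine .inr ⟨i, ?_, hz.symm⟩
    have h2 : (Q.next ^ 2) (attachEnds _ _ (Sum.inl x)) = attachEnds _ _ (Sum.inl (d i)) := by
      rw [pow_two, Equiv.Perm.mul_apply, ← hz, hd]
    have hn1 : n ≠ 1 := by
      rintro rfl
      have : attachEnds E _ (Sum.inr (freeEnd i)) = attachEnds _ _ (Sum.inl (P.next x)) :=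
        hz.trans hret
      simp at this
    obtain rfl : n = 2 := by
      by_contra hne
      exact hmin 2 two_pos (by omega) (d i) h2
    exact Sum.inl.inj ((attachEnds _ _).injective (h2.symm.trans hret))

theorem exists_next_eq [Finite E] [DecidableEq E] {P : G.Rotation} {Q : (G.attach H3 t).Rotation}
    (ht : t.Injective) (hdeg : ∀ i, ∃ d, G.vert d = t i) (hQ : Q.Extends P) :
    ∃ d a b, (∀ i, G.vert (d i) = t i) ∧ Q.next = P.insertNext d a b := by
  choose d hd hfree using Q.exists_next_freeEnd ht hdeg
  choose a ha using Q.next_attachEnds_inr_armVertex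
  choose b hb using Q.next_attachEnds_inr_hubVertex
  have hdi : d.Injective := fun i j h => ht (by rw [← hd, ← hd, h])
  refine ⟨d, a, b, hd, ?_⟩
  ext1 z
  obtain ⟨z, rfl⟩ := (attachEnds _ _).surjective z
  rw [insertNext_apply]
  rcases z with x | z
  · rw [Equiv.Perm.sumCongr_apply, Sum.map_inl]
    rcases next_attachEnds_inl hQ hfree x with ⟨h, hne⟩ | ⟨i, hi, h⟩
    · rw [h, Equiv.Perm.crossSwap_inl_of_ne hne]
    · rw [h, ← hi, Equiv.Perm.crossSwap_inl hdi freeEnd_injective]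
  · rw [Equiv.Perm.sumCongr_apply, Sum.map_inr]
    have hne : ∀ c, H3.vert z = Sum.inr c → ∀ i, freeEnd i ≠ h3Rot a b z := by
      intro c hc i hi
      have := H3_vert_h3Rot a b z
      rw [← hi, hc] at this
      cases this
    rcases hz : H3.vert z with i | i | j
    · obtain rfl := H3_vert_eq_inl hz
      rw [hfree, show h3Rot a b (freeEnd i) = freeEnd i from rfl,
        Equiv.Perm.crossSwap_inr hdi freeEnd_injective]
    · rw [ha i a b rfl z hz, Equiv.Perm.crossSwap_inr_of_ne (hne _ hz)]
    · rw [hb j a b rfl z hz, Equiv.Perm.crossSwap_inr_of_ne (hne _ hz)]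

/-! ### Counting handles -/

theorem not_sameCycle_of_not_onBoundary {P : G.Rotation} {d : Fin 3 → E × Bool}
    (hd : ∀ i, G.vert (d i) = t i)
    (h : ∀ i j, i ≠ j → ¬ ∃ f, P.OnBoundary (t i) f ∧ P.OnBoundary (t j) f) (i j : Fin 3)
    (hij : i ≠ j) : ¬ P.faceStep.SameCycle (d i) (d j) := fun hs =>
  h i j hij ⟨Quotient.mk _ (d i), ⟨d i, rfl, hd i⟩, ⟨d j,
    Quotient.sound (s := Equiv.Perm.SameCycle.setoid P.faceStep) hs.symm, hd j⟩⟩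

variable [Finite V] [Finite E]

theorem eulerChar_le_of_extends (P : G.Rotation) (ht : t.Injective)
    (hdeg : ∀ i, ∃ d, G.vert d = t i) (Q : (G.attach H3 t).Rotation) (hQ : Q.Extends P) :
    Q.eulerChar ≤ P.eulerChar - 2 * ((1 : ℕ) : ℤ) := by
  classical
  obtain ⟨d, a, b, -, hn⟩ := exists_next_eq ht hdeg hQ
  rw [P.eulerChar_of_next_eq d a b Q hn]
  -- Both cases give at most two more faces than `P` has: one face of `H3` with at most two splits,
  -- or at most three faces with at most one split.
  by_cases h : (h3Face a b).SameCycle (freeEnd 1) (freeEnd 0) ∧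
      (h3Face a b).SameCycle (freeEnd 2) (freeEnd 0)
  · have h₁ := cycleCount_h3Face_le_one a b h.1 h.2
    have h₂ := Equiv.Perm.cycleCount_crossSwap_mul_le P.faceStep (h3Face a b) d freeEnd
    push_cast
    omega
  · have h₁ := cycleCount_h3Face_le a b
    have h₂ := Equiv.Perm.cycleCount_crossSwap_mul_lt P.faceStep (h3Face a b) d freeEnd h
    push_cast
    omega

theorem handles_two (P : G.Rotation) (ht : t.Injective) (hdeg : ∀ i, ∃ d, G.vert d = t i)
    (h : ∀ i j, i ≠ j → ¬ ∃ f, P.OnBoundary (t i) f ∧ P.OnBoundary (t j) f) :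
    P.HandlesNecessaryAndSufficient H3 t 2 := by
  classical
  constructor
  · choose d hd using hdeg
    obtain ⟨a, b, -, -, hc⟩ := exists_h3Face_cycleCount_eq 0
    obtain ⟨Q, hQ, hn⟩ := P.exists_extension ht hd a b
    refine ⟨Q, hQ, ?_⟩
    rw [P.eulerChar_of_next_eq d a b Q hn]
    have := Equiv.Perm.cycleCount_crossSwap_mul_of_pairwise P.faceStep (h3Face a b) d freeEnd
      (not_sameCycle_of_not_onBoundary hd h)
    push_cast
    omega
  · intro Q hQ
    obtain ⟨d, a, b, hd, hn⟩ := exists_next_eq ht hdeg hQ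
    rw [P.eulerChar_of_next_eq d a b Q hn]
    have := Equiv.Perm.cycleCount_crossSwap_mul_of_pairwise P.faceStep (h3Face a b) d freeEnd
      (not_sameCycle_of_not_onBoundary hd h)
    have := cycleCount_h3Face_le a b
    push_cast
    omega

theorem handles_one (P : G.Rotation) (ht : t.Injective) (hdeg : ∀ i, ∃ d, G.vert d = t i)
    {i j : Fin 3} (hij : i ≠ j) (h : ∃ f, P.OnBoundary (t i) f ∧ P.OnBoundary (t j) f) :
    P.HandlesNecessaryAndSufficient H3 t 1 := by
  classical
  refine ⟨?_, P.eulerChar_le_of_extends ht hdeg⟩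
  have hk : ∃ k : Fin 3, ∃ f, P.OnBoundary (t (k + 1)) f ∧ P.OnBoundary (t (k + 2)) f := by
    obtain ⟨f, hi, hj⟩ := h
    have : ∃ k : Fin 3, (i = k + 1 ∧ j = k + 2) ∨ (j = k + 1 ∧ i = k + 2) := by
      clear hi hj
      revert i j
      decide
    obtain ⟨k, ⟨rfl, rfl⟩ | ⟨rfl, rfl⟩⟩ := this
    exacts [⟨k, f, hi, hj⟩, ⟨k, f, hj, hi⟩]
  obtain ⟨k, f, ⟨d₁, hf₁, hd₁⟩, d₂, hf₂, hd₂⟩ := hk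
  have hs : P.faceStep.SameCycle d₁ d₂ :=
    Quotient.exact (s := Equiv.Perm.SameCycle.setoid P.faceStep) (hf₁.trans hf₂.symm)
  obtain ⟨d₀, hd₀⟩ := hdeg k
  -- Renumbers the transpositions so that the pair `k + 1`, `k + 2` comes first and `k` last.
  let π : Equiv.Perm (Fin 3) := (Equiv.subRight 2).trans (Equiv.addLeft k)
  have hπ : π 0 = k + 1 ∧ π 1 = k + 2 ∧ π 2 = k := by
    clear * -
    revert k
    decide
  have hd : ∀ i, G.vert ((![d₁, d₂, d₀] ∘ π.symm) i) = t i := by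
    intro i
    obtain ⟨i, rfl⟩ := π.surjective i
    rw [Function.comp_apply, π.symm_apply_apply]
    fin_cases i
    · simpa [hπ.1] using hd₁
    · simpa [hπ.2.1] using hd₂
    · simpa [hπ.2.2] using hd₀
  have hdi : Function.Injective (![d₁, d₂, d₀] ∘ π.symm) := fun i j h => ht (by rw [← hd, ← hd, h])
  obtain ⟨a, b, h₁, h₂, hc⟩ := exists_h3Face_cycleCount_eq k
  obtain ⟨Q, hQ, hn⟩ := P.exists_extension ht hd a b
  refine ⟨Q, hQ, ?_⟩
  rw [P.eulerChar_of_next_eq _ a b Q hn]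
  have hcount := Equiv.Perm.cycleCount_crossSwap_mul_of_pair P.faceStep (h3Face a b)
    ((![d₁, d₂, d₀] ∘ π.symm) ∘ π) (freeEnd ∘ π) (by simpa using hs.symm)
    (by simpa [hπ] using h₁.symm) (by simpa [hπ] using fun h => h₂ (h.trans h₁))
  rw [Equiv.Perm.crossSwap_comp hdi freeEnd_injective] at hcount
  push_cast
  omega

end Rotation

end MultiGraph

/-- `t` is the one-to-one matching of the free nodes of `H₃` to the vertices `u, v, w` of `G`. -/
theorem mainTheorem6 {V E : Type*} [Finite V] [Finite E] (G : MultiGraph V E) (hG : G.Connected)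
    (u v w : V) (huv : u ≠ v) (huw : u ≠ w) (hvw : v ≠ w)
    (hu : G.degree u = 2) (hv : G.degree v = 2) (hw : G.degree w = 2)
    (t : Fin 3 → V) (ht : Function.Injective t) (htr : Set.range t = {u, v, w})
    (P : G.Rotation) :
    ((∃ f : P.Face, P.OnBoundary u f ∧ P.OnBoundary v f ∧ P.OnBoundary w f) →
      P.HandlesNecessaryAndSufficient MultiGraph.H3 t 1) ∧
    (((∃ f : P.Face, P.OnBoundary u f ∧ P.OnBoundary v f) ∨
        (∃ f : P.Face, P.OnBoundary u f ∧ P.OnBoundary w f) ∨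
        (∃ f : P.Face, P.OnBoundary v f ∧ P.OnBoundary w f)) ∧
      (¬ ∃ f : P.Face, P.OnBoundary u f ∧ P.OnBoundary v f ∧ P.OnBoundary w f) →
      P.HandlesNecessaryAndSufficient MultiGraph.H3 t 1) ∧
    ((¬ ∃ f : P.Face, P.OnBoundary u f ∧ P.OnBoundary v f) ∧
        (¬ ∃ f : P.Face, P.OnBoundary u f ∧ P.OnBoundary w f) ∧
        (¬ ∃ f : P.Face, P.OnBoundary v f ∧ P.OnBoundary w f) →
      P.HandlesNecessaryAndSufficient MultiGraph.H3 t 2) := by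
  have hdeg : ∀ i, ∃ d, G.vert d = t i := by
    intro i
    have hi : G.degree (t i) = 2 := by
      have : t i ∈ ({u, v, w} : Set V) := htr ▸ Set.mem_range_self i
      rcases this with h | h | h <;> rw [h] <;> assumption
    have : Nonempty {d : E × Bool // G.vert d = t i} :=
      (Nat.card_pos_iff.1 (lt_of_lt_of_eq two_pos hi.symm)).1
    exact nonempty_subtype.1 this
  obtain ⟨i, rfl⟩ : u ∈ Set.range t := htr ▸ by simp
  obtain ⟨j, rfl⟩ : v ∈ Set.range t := htr ▸ by simp
  obtain ⟨k, rfl⟩ : w ∈ Set.range t := htr ▸ by simp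
  have hij : i ≠ j := fun h => huv (congrArg t h)
  have hik : i ≠ k := fun h => huw (congrArg t h)
  have hjk : j ≠ k := fun h => hvw (congrArg t h)
  refine ⟨fun ⟨f, h₁, h₂, _⟩ => P.handles_one ht hdeg hij ⟨f, h₁, h₂⟩, ?_, ?_⟩
  · rintro ⟨h | h | h, -⟩
    · exact P.handles_one ht hdeg hij h
    · exact P.handles_one ht hdeg hik h
    · exact P.handles_one ht hdeg hjk h
  · rintro ⟨h₁, h₂, h₃⟩
    refine P.handles_two ht hdeg fun l m hlm => ?_
    have hcases : ∀ n : Fin 3, n = i ∨ n = j ∨ n = k := by omega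
    rcases hcases l with rfl | rfl | rfl <;> rcases hcases m with rfl | rfl | rfl <;>
      first
        | exact absurd rfl hlm
        | assumption
        | exact fun ⟨f, hl, hm⟩ => h₁ ⟨f, hm, hl⟩
        | exact fun ⟨f, hl, hm⟩ => h₂ ⟨f, hm, hl⟩
        | exact fun ⟨f, hl, hm⟩ => h₃ ⟨f, hm, hl⟩
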